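/- **Theorem 4.1.** Let $\Omega\subset\mathbb R^2$ be a bounded convex polygonal domain with $\partial\Omega=\Gamma_D\cup\Gamma_N$ and $\operatorname{meas}(\Gamma_D)>0$, where $\operatorname{meas}$ is arc length. Put $V=\{v\in H^1(\Omega)^2: v|_{\Gamma_D}=0\}$ and $\Sigma=L^2(\Omega;\mathbb R^{2\times2}_{sym})$, with the additional condition $\int_\Omega\operatorname{tr}\tau\,dx=0$ on $\tau\in\Sigma$ if $\operatorname{meas}(\Gamma_N)=0$. Let $\varepsilon(v)=\frac12(\nabla v+\nabla^Tv)$, $\sigma:\tau=\sum_{i,j}\sigma_{ij}\tau_{ij}$, $\|\tau\|_0^2=\int_\Omega\tau:\tau\,dx$, $|v|_1=\|\nabla v\|_0$, and, for Lamé parameters $\mu,\lambda>0$, $$a(\sigma,\tau)=\frac1{2\mu}\int_\Omega\Big(\sigma:\tau-\frac{\lambda}{2(\mu+\lambda)}\operatorname{tr}\sigma\operatorname{tr}\tau\Big)dx .$$ Let $T_h$ be a conforming mesh of $\Omega$ by convex quadrilaterals. For $K\in T_h$ with vertices $Z_1,\dots,Z_4$ in counterclockwise order let $F_K:\hat K=[-1,1]^2\to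 K$ be the bilinear map taking the corners $(-1,-1),(1,-1),(1,1),(-1,1)$ to $Z_1,\dots,Z_4$, $$F_K(\xi,\eta)=(a_0+a_1\xi+a_2\eta+a_{12}\xi\eta,\; b_0+b_1\xi+b_2\eta+b_{12}\xi\eta),$$ the vertices being numbered so that $a_1>0$ and $b_2>0$. Let $h_K$ be the diameter of $K$ and $\rho_K$ the smallest diameter of the circles inscribed in the four triangles $Z_{i-1}Z_iZ_{i+1}$ (indices modulo 4). Define - $V_h=\{v\in V: v|_K\circ F_K\in Q_1(\hat K)^2 \text{ for all } K\in T_h\}$; - $\Sigma_h^{PS}$, the set of $\tau\in\Sigma$ such that for every $K\in T_h$ there is $\beta\in\mathbb R^5$ with $$\begin{pmatrix}\tau_{11}\\ \tau_{22}\\ \tau_{12}\end{pmatrix}\circ F_K=\begin{pmatrix}1&0&0&\eta&\frac{a_2^2}{b_2^2}\xi\\ 0&1&0&\frac{b_1^2}{a_1^2}\eta&\xi\\ 0&0&1&\frac{b_1}{a_1}\eta&\frac{a_2}{b_2}\xi\end{pmatrix}\beta;$$ - $Z_h=\{\tau\in\Sigma_h^{PS}:\int_\Omega\tau:\varepsilon(v)\,dx=0\text{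 for all }v\in V_h\}$; - $\bar W_h$, the set of functions on $\Omega$ that are constant on each $K\in T_h$, with the additional condition $\int_\Omega\bar q\,dx=0$ if $\operatorname{meas}(\Gamma_N)=0$. Let $\varrho>2$, $C_0>0$ and $\mu_0>0$. Then there is a constant $C>0$, depending only on $\Omega,\Gamma_D,\Gamma_N,\varrho,C_0,\mu_0$, such that the following holds for all such meshes $T_h$ and all $\mu\in(0,\mu_0]$, $\lambda>0$. If $T_h$ is shape regular, $h_K\le\varrho\rho_K$ for all $K\in T_h$, and the $Q_1$–$P_0$ Stokes pair is stable on $T_h$ with constant $C_0$, that is, for every $\bar q\in\bar W_h$ there is $v\in V_h$ with $$\|\bar q\|_0^2\le C_0\int_\Omega\bar q\,\operatorname{div}v\,dx,\qquad |v|_1^2\le C_0\|\bar q\|_0^2,$$ then $$\|\tau\|_0^2\le C\,a(\tau,\tau)\qquad\text{for all }\tau\in Z_h .$$ In particular $C$ is independent of the mesh size $h$ and of $\lambda$. -/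

import Mathlib

open MeasureTheory Set
open scoped MeasureTheory ContDiff

noncomputable section

namespace PSHybrid

/-- The Euclidean plane; it contains both the physical domain and the reference square. -/
abbrev Plane := EuclideanSpace ℝ (Fin 2)

/-- Real `2 × 2` tensors. -/
abbrev Tensor := Matrix (Fin 2) (Fin 2) ℝ

/-! ### Domain, weak gradient, trace, and the continuous spaces -/

/-- A bounded convex polygonal domain: the nonempty interior of the convex hull of finitely
many points. -/
def IsConvexPolygonalDomain (Ω : Set Plane) : Prop :=
  Ω.Nonempty ∧ ∃ S : Set Plane, S.Finite ∧ Ω = interior (convexHull ℝ S)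

/-- The partial derivative `∂φ/∂x_j` of a differentiable scalar function. -/
def partialDeriv (j : Fin 2) (φ : Plane → ℝ) (x : Plane) : ℝ :=
  fderiv ℝ φ x (EuclideanSpace.single j 1)

/-- The tensor field `G` is square integrable on `Ω` and is the weak gradient of the vector
field `v` there: `G i j = ∂ v_i / ∂ x_j` in the sense of distributions on `Ω`. -/
structure IsWeakGradient (Ω : Set Plane) (v : Plane → Plane) (G : Plane → Tensor) : Prop where
  memLp : ∀ i j, MemLp (fun x => G x i j) 2 (volume.restrict Ω)
  parts : ∀ φ : Plane → ℝ, ContDiff ℝ ∞ φ → HasCompactSupport φ → tsupport φ ⊆ Ω →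
    ∀ i j, ∫ x in Ω, v x i * partialDeriv j φ x = -∫ x in Ω, G x i j * φ x

/-- The space `H¹(Ω)²`. -/
def MemH1 (Ω : Set Plane) (v : Plane → Plane) : Prop :=
  MemLp v 2 (volume.restrict Ω) ∧ ∃ G, IsWeakGradient Ω v G

open Classical in
/-- The weak gradient of `v ∈ H¹(Ω)²`, which is unique up to a null set. -/
def weakGrad (Ω : Set Plane) (v : Plane → Plane) : Plane → Tensor :=
  if h : ∃ G, IsWeakGradient Ω v G then h.choose else 0

/-- `n` is an outward unit normal of the convex set `Ω` at the boundary point `x`. On a convex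
polygon it is unique except at the vertices. -/
def IsOuterNormal (Ω : Set Plane) (x n : Plane) : Prop :=
  ‖n‖ = 1 ∧ ∀ y ∈ Ω, inner ℝ n (y - x) ≤ 0

open Classical in
/-- The outward unit normal field on the boundary of a convex polygon (defined up to the choice
at the vertices, a null set). -/
def outerNormal (Ω : Set Plane) (x : Plane) : Plane :=
  if h : ∃ n, IsOuterNormal Ω x n then h.choose else 0

/-- `g ∈ L²(∂Ω)²` is the boundary trace of `v ∈ H¹(Ω)²`: it is the boundary field occurring in
Green's formula. Here `μH[1]` is arc length. -/
structure IsTrace (Ω : Set Plane) (v g : Plane → Plane) : Prop where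
  memLp : MemLp g 2 (μH[1].restrict (frontier Ω))
  green : ∀ φ : Plane → ℝ, ContDiff ℝ ∞ φ → ∀ i j,
    ∫ x in Ω, (v x i * partialDeriv j φ x + weakGrad Ω v x i j * φ x)
      = ∫ x in frontier Ω, g x i * φ x * outerNormal Ω x j ∂μH[1]

/-- The displacement space `V = {v ∈ H¹(Ω)² : v = 0 on Γ_D}`. -/
def displacementSpace (Ω ΓD : Set Plane) : Set (Plane → Plane) :=
  {v | MemH1 Ω v ∧ ∃ g, IsTrace Ω v g ∧ ∀ᵐ x ∂(μH[1] : Measure Plane), x ∈ ΓD → g x = 0}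

/-- The divergence of `v`. -/
def divergence (Ω : Set Plane) (v : Plane → Plane) (x : Plane) : ℝ :=
  (weakGrad Ω v x).trace

/-- The strain `ε(v) = (∇v + ∇ᵀv) / 2`. -/
def strain (Ω : Set Plane) (v : Plane → Plane) (x : Plane) : Tensor :=
  (1 / 2 : ℝ) • (weakGrad Ω v x + (weakGrad Ω v x).transpose)

/-- The square `|v|₁²` of the `H¹` semi-norm. -/
def h1SemiSq (Ω : Set Plane) (v : Plane → Plane) : ℝ :=
  ∫ x in Ω, ∑ i, ∑ j, weakGrad Ω v x i j ^ 2

/-- The Frobenius product `σ : τ`. -/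
def ddot (σ τ : Tensor) : ℝ := ∑ i, ∑ j, σ i j * τ i j

/-- The stress space `Σ`: square integrable symmetric tensor fields, whose trace has integral
zero if there is no traction boundary. -/
def stressSpace (Ω ΓN : Set Plane) : Set (Plane → Tensor) :=
  {τ | (∀ i j, MemLp (fun x => τ x i j) 2 (volume.restrict Ω)) ∧
    (∀ᵐ x ∂volume.restrict Ω, (τ x).IsSymm) ∧
    (μH[1] ΓN = 0 → ∫ x in Ω, (τ x).trace = 0)}

/-- The square `‖τ‖₀²` of the `L²` norm of a stress field. -/
def stressNormSq (Ω : Set Plane) (τ : Plane → Tensor) : ℝ :=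
  ∫ x in Ω, ddot (τ x) (τ x)

/-- The complementary energy form `a(σ, τ) = ∫ σ : ℂ⁻¹ τ` with Lamé parameters `mu`, `lam`. -/
def energyForm (Ω : Set Plane) (mu lam : ℝ) (σ τ : Plane → Tensor) : ℝ :=
  1 / (2 * mu) * ∫ x in Ω,
    (ddot (σ x) (τ x) - lam / (2 * (mu + lam)) * ((σ x).trace * (τ x).trace))

/-! ### Quadrilaterals -/

/-- The closed reference square `[-1, 1]²`, with coordinates `ξ = p 0` and `η = p 1`. -/
def refSquare : Set Plane := {p | ∀ i, p i ∈ Icc (-1 : ℝ) 1}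

/-- The bilinear nodal functions on the reference square. -/
def nodal (p : Plane) : Fin 4 → ℝ :=
  ![(1 - p 0) * (1 - p 1) / 4, (1 + p 0) * (1 - p 1) / 4,
    (1 + p 0) * (1 + p 1) / 4, (1 - p 0) * (1 + p 1) / 4]

/-- The isoparametric bilinear map of the quadrilateral with vertices `Z 0, Z 1, Z 2, Z 3`. -/
def isoMap (Z : Fin 4 → Plane) (p : Plane) : Plane := ∑ i, nodal p i • Z i

/-- The closed quadrilateral, as the image of the reference square. -/
def quad (Z : Fin 4 → Plane) : Set Plane := isoMap Z '' refSquare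

/-- The coefficient of `ξ` in `isoMap`, that is `(a₁, b₁)`. -/
def coeffXi (Z : Fin 4 → Plane) : Plane := (1 / 4 : ℝ) • (-Z 0 + Z 1 + Z 2 - Z 3)

/-- The coefficient of `η` in `isoMap`, that is `(a₂, b₂)`. -/
def coeffEta (Z : Fin 4 → Plane) : Plane := (1 / 4 : ℝ) • (-Z 0 - Z 1 + Z 2 + Z 3)

/-- The determinant of two plane vectors. -/
def cross (u w : Plane) : ℝ := u 0 * w 1 - u 1 * w 0

/-- The vertices are those of a nondegenerate convex quadrilateral, in counterclockwise order:
one turns left at each of them. -/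
def IsConvexQuad (Z : Fin 4 → Plane) : Prop :=
  ∀ i, 0 < cross (Z (i + 1) - Z i) (Z (i + 2) - Z (i + 1))

/-- The diameter of the circle inscribed in the triangle `A B C`: the largest diameter of a disc
contained in the triangle. -/
def inscribedDiam (A B C : Plane) : ℝ :=
  sSup {d : ℝ | 0 ≤ d ∧ ∃ c, Metric.closedBall c (d / 2) ⊆ convexHull ℝ {A, B, C}}

/-- `ρ_K`: the least inscribed diameter of the four triangles formed by consecutive vertices. -/
def rho (Z : Fin 4 → Plane) : ℝ :=
  Finset.univ.inf' Finset.univ_nonempty fun i : Fin 4 => inscribedDiam (Z (i - 1)) (Z i) (Z (i + 1))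

/-- A conforming mesh of `Ω` by convex quadrilaterals. The numbering of the vertices of each
quadrilateral is counterclockwise and starts so that `a₁ > 0` and `b₂ > 0`. -/
structure QuadMesh (Ω : Set Plane) where
  /-- the number of elements -/
  card : ℕ
  /-- the vertices of the elements -/
  vertex : Fin card → Fin 4 → Plane
  convex : ∀ K, IsConvexQuad (vertex K)
  order : ∀ K, 0 < coeffXi (vertex K) 0 ∧ 0 < coeffEta (vertex K) 1
  cover : ⋃ K, quad (vertex K) = closure Ω
  /-- two elements are disjoint or share exactly one vertex or exactly one whole edge -/
  conforming : ∀ K L, K ≠ L →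
    quad (vertex K) ∩ quad (vertex L) = ∅ ∨
    (∃ i j, vertex K i = vertex L j ∧ quad (vertex K) ∩ quad (vertex L) = {vertex K i}) ∨
    (∃ i j, segment ℝ (vertex K i) (vertex K (i + 1)) = segment ℝ (vertex L j) (vertex L (j + 1)) ∧
      quad (vertex K) ∩ quad (vertex L) = segment ℝ (vertex K i) (vertex K (i + 1)))

variable {Ω : Set Plane}

/-- Shape regularity `h_K ≤ ϱ ρ_K` of all elements. -/
def QuadMesh.ShapeRegular (T : QuadMesh Ω) (ϱ : ℝ) : Prop :=
  ∀ K, Metric.diam (quad (T.vertex K)) ≤ ϱ * rho (T.vertex K)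

/-! ### Discrete spaces -/

/-- The isoparametric bilinear displacement space `V_h`. -/
def QuadMesh.displacements (T : QuadMesh Ω) (ΓD : Set Plane) : Set (Plane → Plane) :=
  {v | v ∈ displacementSpace Ω ΓD ∧ ∀ K, ∃ c : Fin 4 → Plane,
    ∀ᵐ p ∂volume.restrict refSquare,
      v (isoMap (T.vertex K) p) = c 0 + p 0 • c 1 + p 1 • c 2 + (p 0 * p 1) • c 3}

/-- The five-parameter Pian–Sumihara stress mode with parameters `β` on the quadrilateral with
vertices `Z`, in reference coordinates. -/
def psMode (Z : Fin 4 → Plane) (β : Fin 5 → ℝ) (p : Plane) : Tensor :=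
  let a₁ := coeffXi Z 0
  let b₁ := coeffXi Z 1
  let a₂ := coeffEta Z 0
  let b₂ := coeffEta Z 1
  let τ₁₁ := β 0 + p 1 * β 3 + a₂ ^ 2 / b₂ ^ 2 * p 0 * β 4
  let τ₂₂ := β 1 + b₁ ^ 2 / a₁ ^ 2 * p 1 * β 3 + p 0 * β 4
  let τ₁₂ := β 2 + b₁ / a₁ * p 1 * β 3 + a₂ / b₂ * p 0 * β 4
  !![τ₁₁, τ₁₂; τ₁₂, τ₂₂]

/-- The Pian–Sumihara stress space. -/
def QuadMesh.psStresses (T : QuadMesh Ω) (ΓN : Set Plane) : Set (Plane → Tensor) :=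
  {τ | τ ∈ stressSpace Ω ΓN ∧ ∀ K, ∃ β : Fin 5 → ℝ,
    ∀ᵐ p ∂volume.restrict refSquare, τ (isoMap (T.vertex K) p) = psMode (T.vertex K) β p}

/-- The discrete kernel `Z_h` of the Pian–Sumihara element. -/
def QuadMesh.psKernel (T : QuadMesh Ω) (ΓD ΓN : Set Plane) : Set (Plane → Tensor) :=
  {τ | τ ∈ T.psStresses ΓN ∧
    ∀ v ∈ T.displacements ΓD, ∫ x in Ω, ddot (τ x) (strain Ω v x) = 0}

/-- The piecewise constant pressures; as for the trace of a stress, their integral is zero if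
there is no traction boundary. -/
def QuadMesh.pressures (T : QuadMesh Ω) (ΓN : Set Plane) : Set (Plane → ℝ) :=
  {q | MemLp q 2 (volume.restrict Ω) ∧
    (∀ K, ∃ c : ℝ, ∀ᵐ x ∂volume.restrict (quad (T.vertex K)), q x = c) ∧
    (μH[1] ΓN = 0 → ∫ x in Ω, q x = 0)}

/-- Stability of the `Q1`–`P0` Stokes pair on the mesh, with constant `C₀`. -/
def QuadMesh.StokesStable (T : QuadMesh Ω) (ΓD ΓN : Set Plane) (C₀ : ℝ) : Prop :=
  ∀ q ∈ T.pressures ΓN, ∃ v ∈ T.displacements ΓD,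
    ∫ x in Ω, q x ^ 2 ≤ C₀ * ∫ x in Ω, q x * divergence Ω v x ∧
    h1SemiSq Ω v ≤ C₀ * ∫ x in Ω, q x ^ 2

end PSHybrid

end

/-!
The form `a(τ, τ)` controls the deviatoric part `dev τ` in `L²` with a constant independent of `λ`,
so what has to be shown is that on the discrete kernel `‖tr τ‖₀ ≤ C ‖dev τ‖₀`. Write `q` for the
elementwise mean of `tr τ`.

*The oscillation `tr τ - q`.* On one element the coefficients of `η` and `ξ` in the trace of a
Pian–Sumihara mode are `(1 + s²) β₄` and `(1 + t²) β₅` with `s = b₁ / a₁`, `t = a₂ / b₂`, while the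
corresponding coefficients of `((τ₁₁ - τ₂₂) / 2, τ₁₂)` are `((1 - s²) / 2, s) β₄` and
`((t² - 1) / 2, t) β₅`, of Euclidean lengths `(1 + s²) |β₄| / 2` and `(1 + t²) |β₅| / 2`. As `1, ξ, η`
are orthogonal on the reference square, the oscillation is bounded there by the deviatoric part,
whatever the shape of the element (`setIntegral_psMode_trace_le`). Passing to the element costs the
ratio of the extreme values of the Jacobian. The Jacobian is affine, and its values at the corners
are half the areas of the corner triangles; these lie between multiples of `ρ_K²` and `h_K²`
(`sq_diam_le_cross`, `cornerCross_le`), so shape regularity bounds the ratio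
(`setIntegral_quad_trace_le`, `exists_pressure`).

*The mean `q`.* It is an admissible pressure, so the stability of the `Q1`–`P0` pair provides a
discrete `v` with `‖q‖₀² ≤ C₀ ∫ q div v` and `|v|₁² ≤ C₀ ‖q‖₀²`. Since `∫ τ : ε(v) = 0`, the integral
of `tr τ div v` equals that of `-2 dev τ : ε(v)`, and Young's inequality bounds `‖q‖₀` by `‖dev τ‖₀` and
`‖tr τ - q‖₀` (`setIntegral_pressure_sq_le`).
-/

namespace PSHybrid

/-! ### The Jacobian of the bilinear map -/

/-- The coefficient `(a₁₂, b₁₂)` of `ξη` in `isoMap`. -/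
noncomputable def coeffTwist (Z : Fin 4 → Plane) : Plane := (1 / 4 : ℝ) • (Z 0 - Z 1 + Z 2 - Z 3)

/-- The Jacobian determinant of `isoMap` at the reference point `p`. -/
noncomputable def jac (Z : Fin 4 → Plane) (p : Plane) : ℝ :=
  cross (coeffXi Z + p 1 • coeffTwist Z) (coeffEta Z + p 0 • coeffTwist Z)

/-- Twice the signed area of the triangle `Z i, Z (i + 1), Z (i + 2)`. -/
noncomputable def cornerCross (Z : Fin 4 → Plane) (i : Fin 4) : ℝ :=
  cross (Z (i + 1) - Z i) (Z (i + 2) - Z (i + 1))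

theorem isoMap_eq (Z : Fin 4 → Plane) (p : Plane) :
    isoMap Z p = (1 / 4 : ℝ) • (Z 0 + Z 1 + Z 2 + Z 3) + p 0 • coeffXi Z + p 1 • coeffEta Z
      + (p 0 * p 1) • coeffTwist Z := by
  simp only [isoMap, Fin.sum_univ_four, nodal, coeffXi, coeffEta, coeffTwist]
  ext i
  simp
  ring

/-- The Jacobian is an affine function, hence the bilinear interpolant of its corner values. -/
theorem jac_eq (Z : Fin 4 → Plane) (p : Plane) :
    jac Z p = ∑ i, nodal p (i + 1) * (cornerCross Z i / 4) := by
  simp [jac, cornerCross, cross, Fin.sum_univ_four, nodal, coeffXi, coeffEta, coeffTwist]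
  ring

theorem nodal_nonneg {p : Plane} (hp : p ∈ refSquare) (i : Fin 4) : 0 ≤ nodal p i := by
  have h0 := hp 0
  have h1 := hp 1
  have a0 : 0 ≤ 1 - p 0 := by linarith [h0.2]
  have a1 : 0 ≤ 1 + p 0 := by linarith [h0.1]
  have a2 : 0 ≤ 1 - p 1 := by linarith [h1.2]
  have a3 : 0 ≤ 1 + p 1 := by linarith [h1.1]
  fin_cases i <;> simp [nodal] <;> positivity

theorem sum_nodal (p : Plane) : ∑ i, nodal p (i + 1) = 1 := by
  simp [Fin.sum_univ_four, nodal]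
  ring

theorem jac_le {Z : Fin 4 → Plane} {p : Plane} (hp : p ∈ refSquare) {M : ℝ}
    (hM : ∀ i, cornerCross Z i ≤ M) : jac Z p ≤ M / 4 := by
  rw [jac_eq]
  calc _ ≤ ∑ i, nodal p (i + 1) * (M / 4) := Finset.sum_le_sum fun i _ =>
        mul_le_mul_of_nonneg_left (by linarith [hM i]) (nodal_nonneg hp _)
    _ = M / 4 := by rw [← Finset.sum_mul, sum_nodal, one_mul]

theorem le_jac {Z : Fin 4 → Plane} {p : Plane} (hp : p ∈ refSquare) {m : ℝ}
    (hm : ∀ i, m ≤ cornerCross Z i) : m / 4 ≤ jac Z p := by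
  rw [jac_eq]
  calc m / 4 = ∑ i, nodal p (i + 1) * (m / 4) := by rw [← Finset.sum_mul, sum_nodal, one_mul]
    _ ≤ _ := Finset.sum_le_sum fun i _ =>
        mul_le_mul_of_nonneg_left (by linarith [hm i]) (nodal_nonneg hp _)

theorem jac_pos {Z : Fin 4 → Plane} (hZ : IsConvexQuad Z) {p : Plane} (hp : p ∈ refSquare) :
    0 < jac Z p := by
  obtain ⟨i₀, -, hi₀⟩ := Finset.exists_min_image Finset.univ (cornerCross Z) Finset.univ_nonempty
  have h : 0 < cornerCross Z i₀ := hZ i₀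
  linarith [le_jac hp fun i => hi₀ i (Finset.mem_univ i)]

/-- The derivative of `isoMap`. -/
noncomputable def isoDeriv (Z : Fin 4 → Plane) (p : Plane) : Plane →L[ℝ] Plane :=
  (EuclideanSpace.proj (0 : Fin 2) : Plane →L[ℝ] ℝ).smulRight (coeffXi Z + p 1 • coeffTwist Z)
    + (EuclideanSpace.proj (1 : Fin 2) : Plane →L[ℝ] ℝ).smulRight
        (coeffEta Z + p 0 • coeffTwist Z)

theorem isoDeriv_apply (Z : Fin 4 → Plane) (p u : Plane) :
    isoDeriv Z p u
      = u 0 • (coeffXi Z + p 1 • coeffTwist Z) + u 1 • (coeffEta Z + p 0 • coeffTwist Z) := by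
  simp [isoDeriv]

theorem det_isoDeriv (Z : Fin 4 → Plane) (p : Plane) : (isoDeriv Z p).det = jac Z p := by
  rw [ContinuousLinearMap.det,
    ← LinearMap.det_toMatrix (EuclideanSpace.basisFun (Fin 2) ℝ).toBasis, Matrix.det_fin_two]
  simp only [LinearMap.toMatrix_apply, OrthonormalBasis.coe_toBasis,
    OrthonormalBasis.coe_toBasis_repr_apply, EuclideanSpace.basisFun_repr,
    EuclideanSpace.basisFun_apply, ContinuousLinearMap.coe_coe, isoDeriv_apply]
  simp [jac, cross]
  ring

theorem hasFDerivAt_isoMap (Z : Fin 4 → Plane) (p : Plane) :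
    HasFDerivAt (isoMap Z) (isoDeriv Z p) p := by
  have h0 : HasFDerivAt (fun q : Plane => q 0)
      (EuclideanSpace.proj (0 : Fin 2) : Plane →L[ℝ] ℝ) p :=
    (EuclideanSpace.proj (0 : Fin 2) : Plane →L[ℝ] ℝ).hasFDerivAt
  have h1 : HasFDerivAt (fun q : Plane => q 1)
      (EuclideanSpace.proj (1 : Fin 2) : Plane →L[ℝ] ℝ) p :=
    (EuclideanSpace.proj (1 : Fin 2) : Plane →L[ℝ] ℝ).hasFDerivAt
  have h := (((h0.smul_const (coeffXi Z)).const_add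
    ((1 / 4 : ℝ) • (Z 0 + Z 1 + Z 2 + Z 3))).add (h1.smul_const (coeffEta Z))).add
    ((h0.mul h1).smul_const (coeffTwist Z))
  rw [funext (isoMap_eq Z)]
  refine h.congr_fderiv ?_
  ext u i
  simp [isoDeriv_apply]
  ring

/-- The bilinear map is injective on the reference square: its increment between `p` and `q` is
its derivative at the midpoint applied to `p - q`, and the Jacobian does not vanish there. -/
theorem injOn_isoMap {Z : Fin 4 → Plane} (hZ : IsConvexQuad Z) : InjOn (isoMap Z) refSquare := by
  intro p hp q hq h
  set m : Plane := (1 / 2 : ℝ) • (p + q) with hm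
  have hmem : m ∈ refSquare := fun i => by
    have h1 := hp i
    have h2 := hq i
    simp only [hm, PiLp.smul_apply, PiLp.add_apply, smul_eq_mul]
    constructor <;> linarith [h1.1, h1.2, h2.1, h2.2]
  have hJ := jac_pos hZ hmem
  have h0 : isoDeriv Z m (p - q) = 0 := by
    have : isoDeriv Z m (p - q) = isoMap Z p - isoMap Z q := by
      rw [isoDeriv_apply, isoMap_eq, isoMap_eq]
      ext i
      simp [hm]
      ring
    rw [this, h, sub_self]
  rw [isoDeriv_apply] at h0
  have e0 := congrArg (fun x : Plane => x 0) h0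
  have e1 := congrArg (fun x : Plane => x 1) h0
  simp only [PiLp.add_apply, PiLp.smul_apply, PiLp.sub_apply, PiLp.zero_apply, smul_eq_mul] at e0 e1
  simp only [jac, cross, PiLp.add_apply, PiLp.smul_apply, smul_eq_mul] at hJ
  -- Cramer's rule for the two components of `p - q`
  have d0 : p 0 - q 0 = 0 := by
    refine (mul_eq_zero.1 ?_).resolve_left hJ.ne'
    linear_combination (coeffEta Z 1 + m 0 * coeffTwist Z 1) * e0
      - (coeffEta Z 0 + m 0 * coeffTwist Z 0) * e1
  have d1 : p 1 - q 1 = 0 := by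
    refine (mul_eq_zero.1 ?_).resolve_left hJ.ne'
    linear_combination (coeffXi Z 0 + m 1 * coeffTwist Z 0) * e1
      - (coeffXi Z 1 + m 1 * coeffTwist Z 1) * e0
  ext i
  fin_cases i
  · exact sub_eq_zero.1 d0
  · exact sub_eq_zero.1 d1

theorem measurableSet_refSquare : MeasurableSet refSquare := by
  have : refSquare = ⋂ i, (fun p : Plane => p i) ⁻¹' Icc (-1 : ℝ) 1 := by
    ext p; simp [refSquare]
  rw [this]
  exact MeasurableSet.iInter fun i => measurableSet_Icc.preimage (by fun_prop)

theorem isCompact_refSquare : IsCompact refSquare := by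
  have : refSquare
      = (EuclideanSpace.equiv (Fin 2) ℝ) ⁻¹' (Set.pi univ fun _ => Icc (-1 : ℝ) 1) := by
    ext p
    simp only [refSquare, mem_ofPred_eq, mem_preimage, mem_univ_pi]
    rfl
  rw [this]
  exact (EuclideanSpace.equiv (Fin 2) ℝ).toHomeomorph.isCompact_preimage.2
    (isCompact_univ_pi fun _ => isCompact_Icc)

theorem continuous_isoMap (Z : Fin 4 → Plane) : Continuous (isoMap Z) :=
  continuous_iff_continuousAt.2 fun p => (hasFDerivAt_isoMap Z p).continuousAt

theorem isCompact_quad (Z : Fin 4 → Plane) : IsCompact (quad Z) :=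
  isCompact_refSquare.image (continuous_isoMap Z)

theorem setIntegral_quad {Z : Fin 4 → Plane} (hZ : IsConvexQuad Z) (f : Plane → ℝ) :
    ∫ x in quad Z, f x = ∫ p in refSquare, jac Z p * f (isoMap Z p) := by
  rw [quad, integral_image_eq_integral_abs_det_fderiv_smul volume measurableSet_refSquare
    (fun p _ => (hasFDerivAt_isoMap Z p).hasFDerivWithinAt) (injOn_isoMap hZ)]
  refine setIntegral_congr_fun measurableSet_refSquare fun p hp => ?_
  simp only [det_isoDeriv, abs_of_pos (jac_pos hZ hp), smul_eq_mul]

theorem vertex_mem_quad (Z : Fin 4 → Plane) (i : Fin 4) : Z i ∈ quad Z := by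
  have key : ∀ a b : ℝ, a ∈ Icc (-1 : ℝ) 1 → b ∈ Icc (-1 : ℝ) 1 → !₂[a, b] ∈ refSquare := by
    intro a b ha hb j
    fin_cases j
    · exact ha
    · exact hb
  have hp : (1 : ℝ) ∈ Icc (-1 : ℝ) 1 := by norm_num
  have hn : (-1 : ℝ) ∈ Icc (-1 : ℝ) 1 := by norm_num
  fin_cases i
  · exact ⟨!₂[-1, -1], key _ _ hn hn, by simp [isoMap, Fin.sum_univ_four, nodal]; norm_num⟩
  · exact ⟨!₂[1, -1], key _ _ hp hn, by simp [isoMap, Fin.sum_univ_four, nodal]; norm_num⟩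
  · exact ⟨!₂[1, 1], key _ _ hp hp, by simp [isoMap, Fin.sum_univ_four, nodal]; norm_num⟩
  · exact ⟨!₂[-1, 1], key _ _ hn hp, by simp [isoMap, Fin.sum_univ_four, nodal]; norm_num⟩

/-! ### Shape regularity bounds the Jacobian -/

theorem cross_le (u w : Plane) : cross u w ≤ ‖u‖ * ‖w‖ := by
  refine le_of_sq_le_sq ?_ (by positivity)
  rw [mul_pow, EuclideanSpace.real_norm_sq_eq, EuclideanSpace.real_norm_sq_eq, Fin.sum_univ_two,
    Fin.sum_univ_two, cross]
  nlinarith [sq_nonneg (u 0 * w 0 + u 1 * w 1)]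

/-- A disc of diameter `d` in a strip parallel to `w` is no wider than the strip. -/
theorem diam_mul_norm_le {A c w : Plane} {d lo hi : ℝ} (hd : 0 ≤ d)
    (h : ∀ x ∈ Metric.closedBall c (d / 2), lo ≤ cross w (x - A) ∧ cross w (x - A) ≤ hi) :
    d * ‖w‖ ≤ hi - lo := by
  rcases eq_or_ne w 0 with rfl | hw
  · have := h c (Metric.mem_closedBall_self (by positivity))
    simp only [norm_zero, mul_zero]
    linarith
  have hn : 0 < ‖w‖ := norm_pos_iff.2 hw
  have hsq : ‖w‖ ^ 2 = w 0 ^ 2 + w 1 ^ 2 := by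
    rw [EuclideanSpace.real_norm_sq_eq, Fin.sum_univ_two]
  set n : Plane := !₂[-w 1, w 0] with hndef
  have hnn : ‖n‖ = ‖w‖ := by
    rw [← sq_eq_sq₀ (norm_nonneg _) (norm_nonneg _), hsq, EuclideanSpace.real_norm_sq_eq,
      Fin.sum_univ_two]
    simp [hndef]
    ring
  have hmem : ∀ s : ℝ, |s| = 1 → c + (s * (d / 2 / ‖w‖)) • n ∈ Metric.closedBall c (d / 2) := by
    intro s hs
    rw [mem_closedBall_iff_norm, add_sub_cancel_left, norm_smul, hnn, Real.norm_eq_abs, abs_mul, hs,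
      abs_of_nonneg (by positivity), one_mul, div_mul_cancel₀ _ hn.ne']
  have hval : ∀ s : ℝ, cross w (c + (s * (d / 2 / ‖w‖)) • n - A)
      = cross w (c - A) + s * (d / 2 * ‖w‖) := by
    intro s
    have : d / 2 * ‖w‖ = d / 2 / ‖w‖ * ‖w‖ ^ 2 := by field_simp
    rw [this, hsq]
    simp [cross, hndef]
    ring
  have h1 := (h _ (hmem 1 (by simp))).2
  have h2 := (h _ (hmem (-1) (by simp))).1
  rw [hval] at h1 h2
  linarith

/-- A disc of diameter `d` in the triangle `A B C`. The longer one, of length `m`, of the sides at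
`A` satisfies `d ≤ 2 m`, as the disc lies in the ball of radius `m` about `A`, and `d m` is at most
twice the area, as the triangle lies in a strip parallel to that side. -/
theorem sq_diam_le_cross {A B C c : Plane} {d : ℝ} (hd : 0 ≤ d)
    (hABC : 0 < cross (B - A) (C - B))
    (h : Metric.closedBall c (d / 2) ⊆ convexHull ℝ {A, B, C}) :
    d ^ 2 ≤ 2 * cross (B - A) (C - B) := by
  set X := cross (B - A) (C - B) with hX
  have hconv : ∀ w : Plane, ∀ lo hi : ℝ,
      Convex ℝ {x : Plane | lo ≤ cross w (x - A) ∧ cross w (x - A) ≤ hi} := by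
    rintro w lo hi x ⟨hx1, hx2⟩ y ⟨hy1, hy2⟩ a b ha hb hab
    have hsum : ∀ r : ℝ, a * r + b * r = r := fun r => by rw [← add_mul, hab, one_mul]
    have e : cross w (a • x + b • y - A) = a * cross w (x - A) + b * cross w (y - A) := by
      obtain rfl : b = 1 - a := by linarith
      simp [cross]
      ring
    constructor
    · rw [e]
      linarith [hsum lo, mul_le_mul_of_nonneg_left hx1 ha, mul_le_mul_of_nonneg_left hy1 hb]
    · rw [e]
      linarith [hsum hi, mul_le_mul_of_nonneg_left hx2 ha, mul_le_mul_of_nonneg_left hy2 hb]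
  have hB : d * ‖B - A‖ ≤ X - 0 := by
    refine diam_mul_norm_le (A := A) (c := c) hd fun x hx => ?_
    refine convexHull_min ?_ (hconv (B - A) 0 X) (h hx)
    rintro y (rfl | rfl | rfl)
    · simpa [cross] using hABC.le
    · have : cross (y - A) (y - A) = 0 := by simp [cross]; ring
      simpa [this] using hABC.le
    · have : cross (B - A) (y - A) = X := by simp [hX, cross]; ring
      simpa [this] using hABC.le
  have hC : d * ‖C - A‖ ≤ 0 - -X := by
    refine diam_mul_norm_le (A := A) (c := c) hd fun x hx => ?_
    refine convexHull_min ?_ (hconv (C - A) (-X) 0) (h hx)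
    rintro y (rfl | rfl | rfl)
    · simpa [cross] using hABC.le
    · have : cross (C - A) (y - A) = -X := by simp [hX, cross]; ring
      simpa [this] using hABC.le
    · have : cross (y - A) (y - A) = 0 := by simp [cross]; ring
      simpa [this] using hABC.le
  set m := max ‖B - A‖ ‖C - A‖ with hm
  have hm0 : 0 ≤ m := (norm_nonneg _).trans (le_max_left _ _)
  have hdm : d * m ≤ X := by
    rcases max_choice ‖B - A‖ ‖C - A‖ with e | e <;> rw [hm, e] <;> linarith
  have hball : Metric.closedBall c (d / 2) ⊆ Metric.closedBall A m := by
    refine h.trans (convexHull_min ?_ (convex_closedBall A m))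
    rintro y (rfl | rfl | rfl)
    · exact Metric.mem_closedBall_self hm0
    · exact mem_closedBall_iff_norm.2 (le_max_left _ _)
    · exact mem_closedBall_iff_norm.2 (le_max_right _ _)
  have hd2 : d ≤ 2 * m := by
    set e : Plane := EuclideanSpace.single 0 (d / 2) with he
    have hen : ‖e‖ = d / 2 := by
      rw [he, PiLp.norm_single, Real.norm_eq_abs, abs_of_nonneg (by positivity)]
    have h1 : c + e ∈ Metric.closedBall A m := hball (by
      rw [mem_closedBall_iff_norm, add_sub_cancel_left, hen])
    have h2 : c - e ∈ Metric.closedBall A m := hball (by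
      rw [mem_closedBall_iff_norm, sub_sub_cancel_left, norm_neg, hen])
    rw [mem_closedBall_iff_norm] at h1 h2
    have h3 := norm_sub_le (c + e - A) (c - e - A)
    have h4 : c + e - A - (c - e - A) = (2 : ℝ) • e := by
      rw [two_smul]; abel
    rw [h4, norm_smul, hen, Real.norm_ofNat] at h3
    linarith
  nlinarith

theorem inscribedDiam_nonneg (A B C : Plane) : 0 ≤ inscribedDiam A B C :=
  Real.sSup_nonneg fun _ hd => hd.1

theorem sq_inscribedDiam_le {A B C : Plane} (hABC : 0 < cross (B - A) (C - B)) :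
    inscribedDiam A B C ^ 2 ≤ 2 * cross (B - A) (C - B) := by
  rw [← Real.le_sqrt (inscribedDiam_nonneg A B C) (by positivity)]
  refine Real.sSup_le (fun d hd => ?_) (Real.sqrt_nonneg _)
  obtain ⟨hd0, c, hc⟩ := hd
  exact (Real.le_sqrt hd0 (by positivity)).2 (sq_diam_le_cross hd0 hABC hc)

/-- On a shape regular quadrilateral the corner values of the Jacobian are comparable. -/
theorem cornerCross_le {Z : Fin 4 → Plane} (hZ : IsConvexQuad Z) {ϱ : ℝ}
    (h : Metric.diam (quad Z) ≤ ϱ * rho Z) (i j : Fin 4) :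
    cornerCross Z j ≤ 2 * ϱ ^ 2 * cornerCross Z i := by
  have hb := (isCompact_quad Z).isBounded
  have hdist : ∀ k l, ‖Z k - Z l‖ ≤ Metric.diam (quad Z) := fun k l => by
    rw [← dist_eq_norm]
    exact Metric.dist_le_diam_of_mem hb (vertex_mem_quad Z k) (vertex_mem_quad Z l)
  have hupper : cornerCross Z j ≤ Metric.diam (quad Z) ^ 2 := by
    refine (cross_le _ _).trans ?_
    rw [sq]
    exact mul_le_mul (hdist _ _) (hdist _ _) (norm_nonneg _) Metric.diam_nonneg
  have hrho : rho Z ≤ inscribedDiam (Z i) (Z (i + 1)) (Z (i + 2)) := by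
    have e1 : i + 1 - 1 = i := add_sub_cancel_right i 1
    have e2 : i + 1 + 1 = i + 2 := add_assoc i 1 1
    refine (Finset.inf'_le _ (Finset.mem_univ (i + 1))).trans_eq ?_
    rw [e1, e2]
  have hrho0 : 0 ≤ rho Z := Finset.le_inf' _ _ fun _ _ => inscribedDiam_nonneg _ _ _
  calc cornerCross Z j ≤ Metric.diam (quad Z) ^ 2 := hupper
    _ ≤ (ϱ * rho Z) ^ 2 := pow_le_pow_left₀ Metric.diam_nonneg h 2
    _ = ϱ ^ 2 * rho Z ^ 2 := mul_pow _ _ _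
    _ ≤ ϱ ^ 2 * inscribedDiam (Z i) (Z (i + 1)) (Z (i + 2)) ^ 2 := by gcongr
    _ ≤ ϱ ^ 2 * (2 * cornerCross Z i) := by
        gcongr
        exact sq_inscribedDiam_le (hZ i)
    _ = 2 * ϱ ^ 2 * cornerCross Z i := by ring

/-! ### Moments of the reference square -/

theorem setIntegral_refSquare_mul (f g : ℝ → ℝ) :
    ∫ p in refSquare, f (p 0) * g (p 1) = (∫ x in (-1)..1, f x) * ∫ y in (-1)..1, g y := by
  have hmp : MeasurePreserving (fun p : Plane => (p 0, p 1)) :=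
    (volume_preserving_finTwoArrow ℝ).comp
      (EuclideanSpace.volume_preserving_symm_measurableEquiv_toLp (Fin 2))
  have hemb : MeasurableEmbedding (fun p : Plane => (p 0, p 1)) :=
    ((MeasurableEquiv.toLp 2 (Fin 2 → ℝ)).symm.trans
      MeasurableEquiv.finTwoArrow).measurableEmbedding
  have hpre : refSquare
      = (fun p : Plane => (p 0, p 1)) ⁻¹' (Icc (-1 : ℝ) 1 ×ˢ Icc (-1 : ℝ) 1) := by
    ext p
    simp only [refSquare, mem_ofPred_eq, Fin.forall_fin_two, mem_preimage, mem_prod]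
  rw [hpre, hmp.setIntegral_preimage_emb hemb (fun z : ℝ × ℝ => f z.1 * g z.2),
    Measure.volume_eq_prod, setIntegral_prod_mul, integral_Icc_eq_integral_Ioc,
    integral_Icc_eq_integral_Ioc, intervalIntegral.integral_of_le (by norm_num),
    intervalIntegral.integral_of_le (by norm_num)]

theorem integrableOn_refSquare {f : Plane → ℝ} (hf : Continuous f) : IntegrableOn f refSquare :=
  hf.continuousOn.integrableOn_compact isCompact_refSquare

theorem setIntegral_refSquare_sq (A B C : ℝ) :
    ∫ p in refSquare, (A + p 1 * B + p 0 * C) ^ 2 = 4 * A ^ 2 + 4 / 3 * (B ^ 2 + C ^ 2) := by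
  have e : ∀ p : Plane, (A + p 1 * B + p 0 * C) ^ 2
      = (A + C * p 0) ^ 2 * 1 + 2 * B * ((A + C * p 0) * p 1) + B ^ 2 * (1 * (p 1) ^ 2) := by
    intro p; ring
  simp_rw [e]
  rw [integral_add, integral_add, integral_const_mul, integral_const_mul,
    setIntegral_refSquare_mul (fun x => (A + C * x) ^ 2) (fun _ => 1),
    setIntegral_refSquare_mul (fun x => A + C * x) (fun y => y),
    setIntegral_refSquare_mul (fun _ => 1) (fun y => y ^ 2)]
  · have h1 : ∫ x in (-1 : ℝ)..1, (A + C * x) ^ 2 = 2 * A ^ 2 + 2 / 3 * C ^ 2 := by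
      have : ∀ x : ℝ, (A + C * x) ^ 2 = A ^ 2 + 2 * A * C * x ^ 1 + C ^ 2 * x ^ 2 := by intro x; ring
      simp_rw [this]
      rw [intervalIntegral.integral_add (by apply Continuous.intervalIntegrable; fun_prop)
          (by apply Continuous.intervalIntegrable; fun_prop),
        intervalIntegral.integral_add (by apply Continuous.intervalIntegrable; fun_prop)
          (by apply Continuous.intervalIntegrable; fun_prop)]
      simp only [intervalIntegral.integral_const, intervalIntegral.integral_const_mul,
        integral_pow, smul_eq_mul]
      norm_num
      ring
    rw [h1]
    simp only [intervalIntegral.integral_const, integral_id, integral_pow, smul_eq_mul]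
    norm_num
    ring
  all_goals exact integrableOn_refSquare (by fun_prop)

/-! ### The deviatoric part of a Pian–Sumihara mode controls its trace -/

/-- The deviatoric part `τ - (tr τ / 2) I`. -/
noncomputable def dev (τ : Tensor) : Tensor := τ - (τ.trace / 2) • (1 : Tensor)

theorem ddot_self_eq (τ : Tensor) : ddot τ τ = ddot (dev τ) (dev τ) + 1 / 2 * τ.trace ^ 2 := by
  simp [ddot, dev, Matrix.trace, Fin.sum_univ_two]
  ring

theorem ddot_dev_self_nonneg (τ : Tensor) : 0 ≤ ddot (dev τ) (dev τ) :=
  Finset.sum_nonneg fun _ _ => Finset.sum_nonneg fun _ _ => mul_self_nonneg _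

/-- For a Pian–Sumihara mode the coefficients `e` of `η` and `ξ` in the trace and the
coefficients `(d₁₁, d₁₂)` in the deviatoric part satisfy `d₁₁² + d₁₂² = e² / 4`, because
`((1 - s²) / 2)² + s² = ((1 + s²) / 2)²` for `s = b₁ / a₁` and for `s = a₂ / b₂`. -/
theorem setIntegral_psMode_trace_le (Z : Fin 4 → Plane) (β : Fin 5 → ℝ) :
    ∫ p in refSquare, ((psMode Z β p).trace - (β 0 + β 1)) ^ 2
      ≤ 2 * ∫ p in refSquare, ddot (dev (psMode Z β p)) (dev (psMode Z β p)) := by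
  set s := coeffXi Z 1 / coeffXi Z 0 with hs
  set t := coeffEta Z 0 / coeffEta Z 1 with ht
  have e1 : ∀ p : Plane, ((psMode Z β p).trace - (β 0 + β 1)) ^ 2
      = (0 + p 1 * ((1 + s ^ 2) * β 3) + p 0 * ((1 + t ^ 2) * β 4)) ^ 2 := by
    intro p
    simp [psMode, Matrix.trace, Fin.sum_univ_two, hs, ht]
    ring
  have e2 : ∀ p : Plane, ddot (dev (psMode Z β p)) (dev (psMode Z β p))
      = 2 * ((β 0 - β 1) / 2 + p 1 * ((1 - s ^ 2) / 2 * β 3)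
            + p 0 * ((t ^ 2 - 1) / 2 * β 4)) ^ 2
        + 2 * (β 2 + p 1 * (s * β 3) + p 0 * (t * β 4)) ^ 2 := by
    intro p
    simp [psMode, ddot, dev, Matrix.trace, Fin.sum_univ_two, hs, ht]
    ring
  simp_rw [e1, e2]
  rw [integral_add (integrableOn_refSquare (by fun_prop)) (integrableOn_refSquare (by fun_prop)),
    integral_const_mul, integral_const_mul, setIntegral_refSquare_sq, setIntegral_refSquare_sq,
    setIntegral_refSquare_sq]
  nlinarith [sq_nonneg (β 0 - β 1), sq_nonneg (β 2)]

theorem continuous_psMode_trace (Z : Fin 4 → Plane) (β : Fin 5 → ℝ) :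
    Continuous fun p => (psMode Z β p).trace := by
  simp only [psMode, Matrix.trace, Fin.sum_univ_two, Matrix.diag_apply, Matrix.of_apply,
    Matrix.cons_val_zero, Matrix.cons_val_one, Matrix.cons_val']
  fun_prop

theorem continuous_ddot_dev_psMode (Z : Fin 4 → Plane) (β : Fin 5 → ℝ) :
    Continuous fun p => ddot (dev (psMode Z β p)) (dev (psMode Z β p)) := by
  simp [psMode, ddot, dev, Matrix.trace, Fin.sum_univ_two]
  fun_prop

theorem continuous_jac (Z : Fin 4 → Plane) : Continuous (jac Z) := by
  unfold jac cross
  simp only [PiLp.add_apply, PiLp.smul_apply, smul_eq_mul]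
  fun_prop

/-- The estimate of `setIntegral_psMode_trace_le` on a physical quadrilateral, where it picks up
the ratio of the extreme values of the Jacobian. -/
theorem setIntegral_quad_trace_le {Z : Fin 4 → Plane} (hZ : IsConvexQuad Z) {ϱ : ℝ}
    (h : Metric.diam (quad Z) ≤ ϱ * rho Z) {τ : Plane → Tensor} {β : Fin 5 → ℝ}
    (hτ : ∀ᵐ p ∂volume.restrict refSquare, τ (isoMap Z p) = psMode Z β p) :
    ∫ x in quad Z, ((τ x).trace - (β 0 + β 1)) ^ 2
      ≤ 4 * ϱ ^ 2 * ∫ x in quad Z, ddot (dev (τ x)) (dev (τ x)) := by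
  obtain ⟨i₀, -, hi₀⟩ := Finset.exists_min_image Finset.univ (cornerCross Z) Finset.univ_nonempty
  set m := cornerCross Z i₀ with hm
  have hm0 : 0 < m := hZ i₀
  have hcont1 := continuous_psMode_trace Z β
  have hcont2 := continuous_ddot_dev_psMode Z β
  have hcontJ := continuous_jac Z
  have hup : ∫ x in quad Z, ((τ x).trace - (β 0 + β 1)) ^ 2
      ≤ 2 * ϱ ^ 2 * m / 4 * ∫ p in refSquare, ((psMode Z β p).trace - (β 0 + β 1)) ^ 2 := by
    rw [setIntegral_quad hZ, ← integral_const_mul]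
    calc _ = ∫ p in refSquare, jac Z p * ((psMode Z β p).trace - (β 0 + β 1)) ^ 2 :=
          integral_congr_ae (hτ.mono fun p hp => by simp only [hp])
      _ ≤ _ := setIntegral_mono_on (integrableOn_refSquare (by fun_prop))
          (integrableOn_refSquare (by fun_prop)) measurableSet_refSquare fun p hp =>
            mul_le_mul_of_nonneg_right (jac_le hp fun j => cornerCross_le hZ h i₀ j)
              (sq_nonneg _)
  have hlow : m / 4 * ∫ p in refSquare, ddot (dev (psMode Z β p)) (dev (psMode Z β p))
      ≤ ∫ x in quad Z, ddot (dev (τ x)) (dev (τ x)) := by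
    rw [setIntegral_quad hZ, ← integral_const_mul]
    calc _ ≤ ∫ p in refSquare, jac Z p * ddot (dev (psMode Z β p)) (dev (psMode Z β p)) :=
          setIntegral_mono_on (integrableOn_refSquare (by fun_prop))
          (integrableOn_refSquare (by fun_prop)) measurableSet_refSquare fun p hp =>
            mul_le_mul_of_nonneg_right (le_jac hp fun j => hi₀ j (Finset.mem_univ j))
              (ddot_dev_self_nonneg _)
      _ = _ := integral_congr_ae (hτ.mono fun p hp => by simp only [hp])
  calc _ ≤ _ := hup
    _ ≤ 2 * ϱ ^ 2 * m / 4 *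
        (2 * ∫ p in refSquare, ddot (dev (psMode Z β p)) (dev (psMode Z β p))) :=
        mul_le_mul_of_nonneg_left (setIntegral_psMode_trace_le Z β) (by positivity)
    _ = 4 * ϱ ^ 2 *
        (m / 4 * ∫ p in refSquare, ddot (dev (psMode Z β p)) (dev (psMode Z β p))) := by ring
    _ ≤ _ := mul_le_mul_of_nonneg_left hlow (by positivity)

/-! ### Splitting integrals over the mesh -/

theorem volume_segment (a b : Plane) : volume (segment ℝ a b) = 0 := by
  have hne : line[ℝ, a, b] ≠ ⊤ := by
    intro h
    have h1 : Module.finrank ℝ (vectorSpan ℝ {a, b}) ≤ 1 :=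
      collinear_iff_finrank_le_one.1 (collinear_pair ℝ a b)
    rw [← direction_affineSpan, h, AffineSubspace.direction_top, finrank_top,
      finrank_euclideanSpace_fin] at h1
    norm_num at h1
  refine measure_mono_null ?_ (Measure.addHaar_affineSubspace volume _ hne)
  rw [← convexHull_pair]
  exact convexHull_subset_affineSpan _

namespace QuadMesh

variable {Ω : Set Plane}

theorem volume_quad_inter_quad (T : QuadMesh Ω) {K L : Fin T.card} (h : K ≠ L) :
    volume (quad (T.vertex K) ∩ quad (T.vertex L)) = 0 := by
  rcases T.conforming K L h with h | ⟨i, j, -, h⟩ | ⟨i, j, -, h⟩ <;> rw [h]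
  · exact measure_empty
  · exact measure_singleton _
  · exact volume_segment _ _

theorem measurableSet_quad (T : QuadMesh Ω) (K : Fin T.card) :
    MeasurableSet (quad (T.vertex K)) :=
  (isCompact_quad _).isClosed.measurableSet

theorem volume_quad_lt_top (T : QuadMesh Ω) (K : Fin T.card) : volume (quad (T.vertex K)) < ⊤ :=
  (isCompact_quad _).measure_lt_top

theorem restrict_domain_eq (T : QuadMesh Ω) (hΩ : IsConvexPolygonalDomain Ω) :
    volume.restrict Ω = volume.restrict (⋃ K, quad (T.vertex K)) := by
  obtain ⟨-, S, -, hS⟩ := hΩ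
  have hconv : Convex ℝ Ω := hS ▸ (convex_convexHull ℝ S).interior
  have hopen : IsOpen Ω := hS ▸ isOpen_interior
  rw [T.cover]
  refine Measure.restrict_congr_set (Filter.EventuallyLE.antisymm
    (ae_le_set.2 (by rw [sdiff_eq_empty.2 subset_closure]; exact measure_empty)) (ae_le_set.2 ?_))
  rw [← hopen.frontier_eq]
  exact hconv.addHaar_frontier volume

theorem restrict_quad_le (T : QuadMesh Ω) (hΩ : IsConvexPolygonalDomain Ω) (K : Fin T.card) :
    volume.restrict (quad (T.vertex K)) ≤ volume.restrict Ω := by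
  rw [T.restrict_domain_eq hΩ]
  exact Measure.restrict_mono (subset_iUnion (fun K => quad (T.vertex K)) K) le_rfl

theorem setIntegral_domain (T : QuadMesh Ω) (hΩ : IsConvexPolygonalDomain Ω) {f : Plane → ℝ}
    (hf : IntegrableOn f Ω) : ∫ x in Ω, f x = ∑ K, ∫ x in quad (T.vertex K), f x := by
  have hf' : IntegrableOn f (⋃ K, quad (T.vertex K)) := by
    rwa [IntegrableOn, ← T.restrict_domain_eq hΩ]
  rw [T.restrict_domain_eq hΩ, integral_iUnion_ae
    (fun K => (T.measurableSet_quad K).nullMeasurableSet)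
    (fun K L h => T.volume_quad_inter_quad h) hf', tsum_fintype]

/-- The function equal to `c K` on the element `K`. Its values on the null set where elements
meet are the sums of the adjacent constants. -/
noncomputable def piecewiseConst (T : QuadMesh Ω) (c : Fin T.card → ℝ) (x : Plane) : ℝ :=
  ∑ K, (quad (T.vertex K)).indicator (fun _ => c K) x

theorem piecewiseConst_ae_eq (T : QuadMesh Ω) (c : Fin T.card → ℝ) (K : Fin T.card) :
    ∀ᵐ x ∂volume.restrict (quad (T.vertex K)), T.piecewiseConst c x = c K := by
  have hnot : ∀ᵐ x : Plane, ∀ L, K ≠ L → x ∉ quad (T.vertex K) ∩ quad (T.vertex L) := by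
    rw [ae_all_iff]
    intro L
    by_cases h : K = L
    · simp [h]
    · simpa [h] using measure_eq_zero_iff_ae_notMem.1 (T.volume_quad_inter_quad h)
  rw [ae_restrict_iff' (T.measurableSet_quad K)]
  filter_upwards [hnot] with x hx hxK
  rw [piecewiseConst, Finset.sum_eq_single K (fun L _ hL => indicator_of_notMem
    (fun hxL => hx L hL.symm ⟨hxK, hxL⟩) _) (fun h => absurd (Finset.mem_univ K) h),
    indicator_of_mem hxK]

theorem memLp_piecewiseConst (T : QuadMesh Ω) (c : Fin T.card → ℝ) :
    MemLp (T.piecewiseConst c) 2 (volume.restrict Ω) :=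
  memLp_finsetSum _ fun K _ => memLp_indicator_const 2 (T.measurableSet_quad K) _
    (Or.inr ((Measure.restrict_apply_le _ _).trans_lt (T.volume_quad_lt_top K)).ne)

theorem isFiniteMeasure_restrict (T : QuadMesh Ω) (hΩ : IsConvexPolygonalDomain Ω) :
    IsFiniteMeasure (volume.restrict Ω) := by
  rw [T.restrict_domain_eq hΩ]
  exact ⟨by
    rw [Measure.restrict_apply_univ]
    exact (isCompact_iUnion fun K => isCompact_quad (T.vertex K)).measure_lt_top⟩

end QuadMesh

/-! ### Square integrable tensor fields and the elementwise mean of the trace -/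

/-- The mean value is the best constant approximation in `L²`. -/
theorem integral_sub_mean_sq_le {α : Type*} [MeasurableSpace α] {ν : Measure α}
    [IsFiniteMeasure ν] {f : α → ℝ} (hf : MemLp f 2 ν) {m : ℝ}
    (hm : ∫ x, f x ∂ν = ν.real univ * m) (b : ℝ) :
    ∫ x, (f x - m) ^ 2 ∂ν ≤ ∫ x, (f x - b) ^ 2 ∂ν := by
  have hfi : Integrable f ν := hf.integrable (by norm_num)
  have h1 : Integrable (fun x => (f x - m) ^ 2) ν := (hf.sub (memLp_const m)).integrable_sq
  have h2 : Integrable (fun x => 2 * (m - b) * (f x - m)) ν :=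
    (hfi.sub (integrable_const m)).const_mul _
  have e : ∀ x, (f x - b) ^ 2 = (f x - m) ^ 2 + (2 * (m - b) * (f x - m) + (m - b) ^ 2) := by
    intro x; ring
  have h3 : ∫ x, (f x - m) ∂ν = 0 := by
    rw [integral_sub hfi (integrable_const m), hm, integral_const, smul_eq_mul, sub_self]
  have h4 : Integrable (fun x => 2 * (m - b) * (f x - m) + (m - b) ^ 2) ν :=
    h2.add (integrable_const _)
  simp_rw [e]
  rw [integral_add h1 h4, integral_add h2 (integrable_const _),
    integral_const_mul, h3, integral_const, smul_eq_mul]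
  have : 0 ≤ ν.real univ * (m - b) ^ 2 := by positivity
  linarith

theorem memLp_trace {ν : Measure Plane} {A : Plane → Tensor}
    (hA : ∀ i j, MemLp (fun x => A x i j) 2 ν) : MemLp (fun x => (A x).trace) 2 ν := by
  simp only [Matrix.trace, Matrix.diag_apply]
  exact memLp_finsetSum _ fun i _ => hA i i

theorem memLp_dev {ν : Measure Plane} {A : Plane → Tensor}
    (hA : ∀ i j, MemLp (fun x => A x i j) 2 ν) (i j : Fin 2) :
    MemLp (fun x => dev (A x) i j) 2 ν := by
  refine ((hA i j).sub ((memLp_trace hA).const_mul ((1 : Tensor) i j / 2))).ae_eq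
    (Filter.Eventually.of_forall fun x => ?_)
  simp only [dev, Pi.sub_apply, Matrix.sub_apply, Matrix.smul_apply, smul_eq_mul]
  ring

theorem integrable_ddot {ν : Measure Plane} {A B : Plane → Tensor}
    (hA : ∀ i j, MemLp (fun x => A x i j) 2 ν) (hB : ∀ i j, MemLp (fun x => B x i j) 2 ν) :
    Integrable (fun x => ddot (A x) (B x)) ν :=
  integrable_finsetSum _ fun i _ => integrable_finsetSum _ fun j _ =>
    (hA i j).integrable_mul (hB i j)

theorem memLp_weakGrad {Ω : Set Plane} {v : Plane → Plane} (hv : MemH1 Ω v) (i j : Fin 2) :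
    MemLp (fun x => weakGrad Ω v x i j) 2 (volume.restrict Ω) := by
  rw [weakGrad, dif_pos hv.2]
  exact hv.2.choose_spec.memLp i j

/-- The elementwise mean `q` of the trace of a Pian–Sumihara stress is an admissible pressure, and
`tr τ - q` is controlled by the deviatoric part of `τ`. -/
theorem exists_pressure {Ω ΓN : Set Plane} (hΩ : IsConvexPolygonalDomain Ω) {T : QuadMesh Ω}
    {ϱ : ℝ} (hT : T.ShapeRegular ϱ) {τ : Plane → Tensor} (hτ : τ ∈ T.psStresses ΓN) :
    ∃ q ∈ T.pressures ΓN, ∫ x in Ω, ((τ x).trace - q x) ^ 2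
      ≤ 4 * ϱ ^ 2 * ∫ x in Ω, ddot (dev (τ x)) (dev (τ x)) := by
  obtain ⟨⟨hL, -, hmean⟩, hloc⟩ := hτ
  choose β hβ using hloc
  have := T.isFiniteMeasure_restrict hΩ
  have htr := memLp_trace hL
  have htrK : ∀ K, MemLp (fun x => (τ x).trace) 2 (volume.restrict (quad (T.vertex K))) :=
    fun K => htr.mono_measure (T.restrict_quad_le hΩ K)
  have hfin : ∀ K, IsFiniteMeasure (volume.restrict (quad (T.vertex K))) := fun K =>
    ⟨by rw [Measure.restrict_apply_univ]; exact T.volume_quad_lt_top K⟩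
  set c : Fin T.card → ℝ := fun K => ⨍ x in quad (T.vertex K), (τ x).trace with hc
  have hcK : ∀ K, ∫ x in quad (T.vertex K), (τ x).trace
      = (volume.restrict (quad (T.vertex K))).real univ * c K := fun K => by
    rw [← smul_eq_mul, hc]
    exact (measure_smul_average _ _).symm
  have hq := T.memLp_piecewiseConst c
  refine ⟨T.piecewiseConst c, ⟨hq, fun K => ⟨c K, T.piecewiseConst_ae_eq c K⟩, fun h => ?_⟩, ?_⟩
  · rw [← hmean h, T.setIntegral_domain hΩ (hq.integrable (by norm_num)),
      T.setIntegral_domain hΩ (htr.integrable (by norm_num))]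
    refine Finset.sum_congr rfl fun K _ => ?_
    rw [integral_congr_ae (T.piecewiseConst_ae_eq c K), hcK, integral_const, smul_eq_mul]
  · have hsq : IntegrableOn (fun x => ((τ x).trace - T.piecewiseConst c x) ^ 2) Ω :=
      (htr.sub hq).integrable_sq
    rw [T.setIntegral_domain hΩ hsq,
      T.setIntegral_domain hΩ (integrable_ddot (memLp_dev hL) (memLp_dev hL)), Finset.mul_sum]
    refine Finset.sum_le_sum fun K _ => ?_
    have := hfin K
    calc ∫ x in quad (T.vertex K), ((τ x).trace - T.piecewiseConst c x) ^ 2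
        = ∫ x in quad (T.vertex K), ((τ x).trace - c K) ^ 2 :=
          integral_congr_ae ((T.piecewiseConst_ae_eq c K).mono fun x hx => by simp only [hx])
      _ ≤ ∫ x in quad (T.vertex K), ((τ x).trace - (β K 0 + β K 1)) ^ 2 :=
          integral_sub_mean_sq_le (htrK K) (hcK K) _
      _ ≤ _ := setIntegral_quad_trace_le (T.convex K) (hT K) (hβ K)

/-! ### The trace is controlled through the inf-sup condition -/

/-- With `E` the symmetric part of `G`, `q tr G = 2 τ : E - 2 dev τ : E - (tr τ - q) tr G`; Young's
inequality with weight `δ` bounds the last two terms. -/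
theorem mul_trace_le (τ G : Tensor) (q : ℝ) {δ : ℝ} (hδ : 0 < δ) :
    q * G.trace ≤ 2 * ddot τ ((1 / 2 : ℝ) • (G + G.transpose))
      + (1 / δ * ddot (dev τ) (dev τ) + 1 / (2 * δ) * (τ.trace - q) ^ 2 + 2 * δ * ddot G G) := by
  set E : Tensor := (1 / 2 : ℝ) • (G + G.transpose) with hE
  have e1 : q * G.trace = 2 * ddot τ E - 2 * ddot (dev τ) E - (τ.trace - q) * G.trace := by
    simp [hE, ddot, dev, Matrix.trace, Fin.sum_univ_two]
    ring
  have young : ∀ x y : ℝ, -(2 * (x * y)) ≤ 1 / δ * (x * x) + δ * (y * y) := by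
    intro x y
    have : 1 / δ * (x * x) + δ * (y * y) + 2 * (x * y) = 1 / δ * (x + δ * y) ^ 2 := by
      field_simp
      ring
    have : 0 ≤ 1 / δ * (x + δ * y) ^ 2 := by positivity
    linarith
  have e2 : -(2 * ddot (dev τ) E) ≤ 1 / δ * ddot (dev τ) (dev τ) + δ * ddot E E := by
    simp only [ddot, Fin.sum_univ_two]
    linarith [young (dev τ 0 0) (E 0 0), young (dev τ 0 1) (E 0 1), young (dev τ 1 0) (E 1 0),
      young (dev τ 1 1) (E 1 1)]
  have e3 : ddot E E ≤ ddot G G := by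
    simp [hE, ddot, Fin.sum_univ_two]
    nlinarith [sq_nonneg (G 0 1 - G 1 0)]
  have e4 : G.trace * G.trace ≤ 2 * ddot G G := by
    simp [ddot, Matrix.trace, Fin.sum_univ_two]
    nlinarith [sq_nonneg (G 0 0 - G 1 1), sq_nonneg (G 0 1), sq_nonneg (G 1 0)]
  have e5 := young (τ.trace - q) G.trace
  have e6 : 1 / (2 * δ) * (τ.trace - q) ^ 2 = 1 / 2 * (1 / δ * ((τ.trace - q) * (τ.trace - q))) := by
    field_simp
  have e7 := mul_le_mul_of_nonneg_left e3 hδ.le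
  have e8 := mul_le_mul_of_nonneg_left e4 hδ.le
  rw [e1, e6]
  linarith

/-- For a stress in the discrete kernel the inf-sup condition bounds a pressure `q` by the
deviatoric stress and by `tr τ - q`. -/
theorem setIntegral_pressure_sq_le {Ω ΓD ΓN : Set Plane} {T : QuadMesh Ω} {C₀ : ℝ} (hC₀ : 0 < C₀)
    (hS : T.StokesStable ΓD ΓN C₀) {τ : Plane → Tensor} (hτ : τ ∈ T.psKernel ΓD ΓN)
    {q : Plane → ℝ} (hq : q ∈ T.pressures ΓN) :
    ∫ x in Ω, q x ^ 2 ≤ 8 * C₀ ^ 3 * (∫ x in Ω, ddot (dev (τ x)) (dev (τ x)))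
      + 4 * C₀ ^ 3 * ∫ x in Ω, ((τ x).trace - q x) ^ 2 := by
  obtain ⟨⟨⟨hL, -, -⟩, -⟩, hker⟩ := hτ
  obtain ⟨v, hv, hdiv, hnorm⟩ := hS q hq
  have hq2 := hq.1
  have hG := memLp_weakGrad hv.1.1
  have hE : ∀ i j, MemLp (fun x => strain Ω v x i j) 2 (volume.restrict Ω) := fun i j =>
    ((hG i j).add (hG j i)).const_mul (1 / 2)
  set δ : ℝ := 1 / (4 * C₀ ^ 2) with hδ
  have hδ0 : 0 < δ := by positivity
  have i1 : IntegrableOn (fun x => q x * divergence Ω v x) Ω := hq2.integrable_mul (memLp_trace hG)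
  have i2 : IntegrableOn (fun x => ddot (τ x) (strain Ω v x)) Ω := integrable_ddot hL hE
  have i3 : IntegrableOn (fun x => ddot (dev (τ x)) (dev (τ x))) Ω :=
    integrable_ddot (memLp_dev hL) (memLp_dev hL)
  have i4 : IntegrableOn (fun x => ((τ x).trace - q x) ^ 2) Ω :=
    ((memLp_trace hL).sub hq2).integrable_sq
  have i5 : IntegrableOn (fun x => ddot (weakGrad Ω v x) (weakGrad Ω v x)) Ω :=
    integrable_ddot hG hG
  have j2 := i2.const_mul 2
  have j3 := i3.const_mul (1 / δ)
  have j4 := i4.const_mul (1 / (2 * δ))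
  have j5 := i5.const_mul (2 * δ)
  have j34 : IntegrableOn (fun x => 1 / δ * ddot (dev (τ x)) (dev (τ x))
      + 1 / (2 * δ) * ((τ x).trace - q x) ^ 2) Ω := j3.add j4
  have j345 : IntegrableOn (fun x => 1 / δ * ddot (dev (τ x)) (dev (τ x))
      + 1 / (2 * δ) * ((τ x).trace - q x) ^ 2
      + 2 * δ * ddot (weakGrad Ω v x) (weakGrad Ω v x)) Ω := j34.add j5
  have hmono := integral_mono i1 (j2.add j345)
    fun x => mul_trace_le (τ x) (weakGrad Ω v x) (q x) hδ0
  simp only [Pi.add_apply] at hmono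
  rw [integral_add j2 j345, integral_add j34 j5, integral_add j3 j4, integral_const_mul,
    integral_const_mul, integral_const_mul, integral_const_mul, hker v hv] at hmono
  have hsemi : ∫ x in Ω, ddot (weakGrad Ω v x) (weakGrad Ω v x) = h1SemiSq Ω v := by
    simp only [ddot, h1SemiSq, sq]
  rw [hsemi] at hmono
  set Q := ∫ x in Ω, q x ^ 2
  set D := ∫ x in Ω, ddot (dev (τ x)) (dev (τ x))
  set R := ∫ x in Ω, ((τ x).trace - q x) ^ 2
  have hN : 2 * δ * h1SemiSq Ω v ≤ 2 * δ * (C₀ * Q) := mul_le_mul_of_nonneg_left hnorm (by positivity)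
  have h1 : Q ≤ C₀ * (1 / δ * D + 1 / (2 * δ) * R + 2 * δ * (C₀ * Q)) :=
    hdiv.trans (mul_le_mul_of_nonneg_left (by linarith) hC₀.le)
  -- the weight `δ` is chosen so that half of `Q` can be absorbed
  have h2 : C₀ * (1 / δ * D + 1 / (2 * δ) * R + 2 * δ * (C₀ * Q))
      = 4 * C₀ ^ 3 * D + 2 * C₀ ^ 3 * R + 1 / 2 * Q := by
    rw [hδ]
    field_simp
    ring
  linarith

/-- The energy controls the deviatoric stress uniformly in `lam`. -/
theorem setIntegral_dev_le_energyForm {Ω : Set Plane} {mu mu₀ lam : ℝ} (hmu : 0 < mu)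
    (hmu₀ : mu ≤ mu₀) (hlam : 0 < lam) {τ : Plane → Tensor}
    (hL : ∀ i j, MemLp (fun x => τ x i j) 2 (volume.restrict Ω)) :
    ∫ x in Ω, ddot (dev (τ x)) (dev (τ x)) ≤ 2 * mu₀ * energyForm Ω mu lam τ τ := by
  have hκ : lam / (2 * (mu + lam)) ≤ 1 / 2 := by
    rw [div_le_div_iff₀ (by positivity) (by norm_num)]
    linarith
  have i1 := integrable_ddot (memLp_dev hL) (memLp_dev hL)
  have i2 : IntegrableOn (fun x => ddot (τ x) (τ x)
      - lam / (2 * (mu + lam)) * ((τ x).trace * (τ x).trace)) Ω :=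
    (integrable_ddot hL hL).sub
      (((memLp_trace hL).integrable_mul (memLp_trace hL)).const_mul _)
  have hle := integral_mono i1 i2 fun x => by
    have := mul_le_mul_of_nonneg_right hκ (mul_self_nonneg (τ x).trace)
    simp only [ddot_self_eq (τ x), sq]
    linarith
  have h0 : 0 ≤ ∫ x in Ω, ddot (dev (τ x)) (dev (τ x)) :=
    integral_nonneg fun x => ddot_dev_self_nonneg (τ x)
  have h1 : 1 ≤ mu₀ / mu := (one_le_div hmu).2 hmu₀
  rw [energyForm]
  set I := ∫ x in Ω, (ddot (τ x) (τ x) - lam / (2 * (mu + lam)) * ((τ x).trace * (τ x).trace))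
  have h2 : 2 * mu₀ * (1 / (2 * mu) * I) = mu₀ / mu * I := by
    field_simp
  rw [h2]
  exact hle.trans (le_mul_of_one_le_left (h0.trans hle) h1)

end PSHybrid

open PSHybrid in
theorem theorem4p1 (Ω ΓD ΓN : Set PSHybrid.Plane)
    (hΩ : PSHybrid.IsConvexPolygonalDomain Ω)
    (hΓ : ΓD ∪ ΓN = frontier Ω) (hΓD : 0 < μH[1] ΓD)
    (ϱ C₀ mu₀ : ℝ) (hϱ : 2 < ϱ) (hC₀ : 0 < C₀) (hmu₀ : 0 < mu₀) :
    ∃ C : ℝ, 0 < C ∧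
      ∀ T : PSHybrid.QuadMesh Ω, T.ShapeRegular ϱ → T.StokesStable ΓD ΓN C₀ →
      ∀ mu lam : ℝ, 0 < mu → mu ≤ mu₀ → 0 < lam →
      ∀ τ ∈ T.psKernel ΓD ΓN,
        PSHybrid.stressNormSq Ω τ ≤ C * PSHybrid.energyForm Ω mu lam τ τ := by
  refine ⟨(1 + 8 * C₀ ^ 3 + (4 * C₀ ^ 3 + 1) * (4 * ϱ ^ 2)) * (2 * mu₀), by positivity, ?_⟩
  intro T hT hS mu lam hmu hmule hlam τ hτ
  obtain ⟨q, hq, hR⟩ := exists_pressure hΩ hT hτ.1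
  have hL := hτ.1.1.1
  have hQ := setIntegral_pressure_sq_le hC₀ hS hτ hq
  have hD := setIntegral_dev_le_energyForm hmu hmule hlam hL
  have i1 : IntegrableOn (fun x => ddot (dev (τ x)) (dev (τ x))) Ω :=
    integrable_ddot (memLp_dev hL) (memLp_dev hL)
  have i2 : IntegrableOn (fun x => q x ^ 2) Ω := hq.1.integrable_sq
  have i3 : IntegrableOn (fun x => ((τ x).trace - q x) ^ 2) Ω :=
    ((memLp_trace hL).sub hq.1).integrable_sq
  have hsplit : stressNormSq Ω τ ≤ (∫ x in Ω, ddot (dev (τ x)) (dev (τ x)))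
      + (∫ x in Ω, q x ^ 2) + ∫ x in Ω, ((τ x).trace - q x) ^ 2 := by
    have i12 : IntegrableOn (fun x => ddot (dev (τ x)) (dev (τ x)) + q x ^ 2) Ω := i1.add i2
    rw [stressNormSq, ← integral_add i1 i2, ← integral_add i12 i3]
    refine integral_mono (integrable_ddot hL hL) (i12.add i3) fun x => ?_
    simp only [ddot_self_eq (τ x)]
    nlinarith [sq_nonneg ((τ x).trace - 2 * q x)]
  set D := ∫ x in Ω, ddot (dev (τ x)) (dev (τ x))
  set R := ∫ x in Ω, ((τ x).trace - q x) ^ 2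
  have hR' := mul_le_mul_of_nonneg_left hR (by positivity : 0 ≤ 4 * C₀ ^ 3 + 1)
  calc stressNormSq Ω τ
      ≤ (1 + 8 * C₀ ^ 3 + (4 * C₀ ^ 3 + 1) * (4 * ϱ ^ 2)) * D := by linarith
    _ ≤ (1 + 8 * C₀ ^ 3 + (4 * C₀ ^ 3 + 1) * (4 * ϱ ^ 2))
        * (2 * mu₀ * energyForm Ω mu lam τ τ) := mul_le_mul_of_nonneg_left hD (by positivity)
    _ = _ := by ring
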